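/- Let $M\ge 0$, $N\ge 2$, $0<s<1$, and let $f_n(x)=s^{a_n}O_n(x)+q_n$ ($n=1,\dots,N$) be similitudes of $\mathbb{R}^M$ with $O_n$ orthogonal, $q_n\in\mathbb{R}^M$, and positive integers $a_n$ with $\gcd(a_1,\dots,a_N)=1$. Let $A$ be the attractor, i.e. the unique nonempty compact set with $A=\bigcup_n f_n(A)$, and assume $\dim_H(f_i(A)\cap f_j(A))<\dim_H(A)$ for all $i\ne j$ (a tiling IFS, TIFS, whose graph has a single vertex). For a finite word $\sigma=\sigma_1\cdots\sigma_k$ in the symbols $1,\dots,N$ let $\xi(\sigma)=a_{\sigma_1}+\cdots+a_{\sigma_k}$ (so $\xi(\varnothing)=0$), $f_\sigma=f_{\sigma_1}\cdots f_{\sigma_k}$, $f_{-\sigma}=f_{\sigma_1}^{-1}\cdots f_{\sigma_k}^{-1}$, and let $\sigma^-$ be $\sigma$ without its last letter. Let $\Omega_k=\{\sigma:\xi(\sigma^-)\le k<\xi(\sigma)\}$. For an infinite word $\theta$, let $\theta|k$ be its prefix of length $k$, $S$ the shift, and $$\Pi(\theta)=\bigcup_{k\ge1}\{f_{-\theta|k}f_\sigma(A):\sigma\in\Omega_{\xi(\theta|k)}\},\qquad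 \mathbb{T}_\infty=\{\Pi(\theta):\theta \text{ an infinite word}\}.$$ Let $\mathcal{T}$ be a group of isometries of $\mathbb{R}^M$ that contains all isometries in the group generated by $f_1,\dots,f_N$ (for instance, all isometries in the group generated by $f_1,\dots,f_N$ and multiplication by $s$). Let $T_0=\{f_n(A):1\le n\le N\}$. Assume that the TIFS is locally rigid with respect to $\mathcal{T}$: (i) if $E\in\mathcal{T}$ is such that $T_0$ and $ET_0$ have a tile in common and $T_0\cap ET_0$ tiles $A\cap EA$, in the sense that the common tiles cover $A\cap EA$ up to a set of Hausdorff dimension less than $\dim_H A$, then $E=\mathrm{id}$; (ii) the identity is the only isometry of the form $f_{-\theta}f_\sigma$ ($\theta,\sigma$ finite words) that maps $A$ onto itself. Let $\widetilde\Sigma$ be the set of classes $[\theta]$ of infinite words, where $\theta\sim\psi$ if there are $p,q$ with $\xi(\theta|p)=\xi(\psi|q)$ and $S^p\theta=S^q\psi$. Let $\widetilde{\mathbb{T}}$ be the set of classes $[T]$ of $T\in\mathbb{T}_\infty$, where $T\sim T'$ if $E_1T=E_2T'$ for some $E_1,E_2\in\mathcal{T}$. Give both the discrete topology. Then: 1.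 For every infinite word $\theta$ and all sufficiently large $j$ there are finite words $w,w'$ with $\xi(w)=\xi(\theta|j)-1$ and $\xi(w')=\xi(\theta|j)+1$. The modified shift $$\widetilde S[\theta]=[w\,\theta_{j+1}\theta_{j+2}\cdots]\quad\text{whenever }\xi(w)=\xi(\theta|j)-1$$ is a well-defined map $\widetilde S:\widetilde\Sigma\to\widetilde\Sigma$ (independent of the representative $\theta$, of $j$ and of $w$). It is a homeomorphism, and its inverse is given by $\widetilde S^{-1}[\theta]=[w'\,\theta_{j+1}\theta_{j+2}\cdots]$ whenever $\xi(w')=\xi(\theta|j)+1$. 2. $\widetilde\Pi[\theta]=[\Pi(\theta)]$ is a well-defined homeomorphism $\widetilde\Pi:\widetilde\Sigma\to\widetilde{\mathbb{T}}$. 3. The deflation/inflation map $\widetilde\alpha:\widetilde{\mathbb{T}}\to\widetilde{\mathbb{T}}$ is a well-defined homeomorphism given by $\widetilde\alpha[\Pi(\theta)]=[\Pi(\psi)]$ for any $\psi$ with $[\psi]=\widetilde S[\theta]$, and $\widetilde\alpha^{-1}[\Pi(\theta)]=[\Pi(\psi)]$ for any $\psi$ with $[\psi]=\widetilde S^{-1}[\theta]$.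 4. $\widetilde\Pi\circ\widetilde S=\widetilde\alpha\circ\widetilde\Pi$ and $\widetilde\Pi^{-1}\circ\widetilde\alpha^{-1}=\widetilde S^{-1}\circ\widetilde\Pi^{-1}$; in particular $\widetilde S$ and $\widetilde\alpha$ are conjugate via $\widetilde\Pi$. -/

import Mathlib

open Topology Filter TopologicalSpace

/-- Euclidean space `ℝ^M`. -/
abbrev Euc (M : ℕ) : Type := EuclideanSpace ℝ (Fin M)

/-- The group of all isometries of `ℝ^M`, as a subgroup of the group of bijections. -/
def euclideanIsometries (M : ℕ) : Subgroup (Equiv.Perm (Euc M)) where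
  carrier := {g | Isometry g}
  mul_mem' {g h} hg hh := by
    change Isometry (g ∘ h)
    exact Isometry.comp hg hh
  one_mem' := isometry_id
  inv_mem' {g} hg := by
    change Isometry g at hg
    change Isometry (g⁻¹ : Equiv.Perm (Euc M))
    exact hg.right_inv (fun x => g.apply_symm_apply x)

/-- The image `E T = {E t : t ∈ T}` of a family `T` of subsets of `ℝ^M` under a map `E`. -/
def moveTiling {M : ℕ} (E : Equiv.Perm (Euc M)) (T : Set (Set (Euc M))) : Set (Set (Euc M)) :=
  (fun t => E '' t) '' T

/-- An iterated function system of `N ≥ 2` contractive similitudes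
`f_n(x) = s^(a_n) O_n(x) + q_n` of `ℝ^M`, where `0 < s < 1`, the exponents `a_n` are positive
integers and the `O_n` are orthogonal. (It is a graph-directed system whose graph has a single
vertex and `N` loops, so that every word in the `N` symbols is an admissible path.) -/
structure SimilitudeIFS (M N : ℕ) where
  two_le : 2 ≤ N
  s : ℝ
  s_pos : 0 < s
  s_lt_one : s < 1
  a : Fin N → ℕ
  a_pos : ∀ n, 0 < a n
  O : Fin N → (Euc M ≃ₗᵢ[ℝ] Euc M)
  q : Fin N → Euc M

namespace SimilitudeIFS

variable {M N : ℕ} (F : SimilitudeIFS M N)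

/-- The map `f_n(x) = s^(a_n) O_n(x) + q_n`, as a bijection of `ℝ^M`. -/
noncomputable def map (n : Fin N) : Equiv.Perm (Euc M) where
  toFun x := F.s ^ F.a n • F.O n x + F.q n
  invFun y := (F.O n).symm ((F.s ^ F.a n)⁻¹ • (y - F.q n))
  left_inv x := by
    have h : F.s ^ F.a n ≠ 0 := pow_ne_zero _ F.s_pos.ne'
    simp [smul_smul, inv_mul_cancel₀ h]
  right_inv y := by
    have h : F.s ^ F.a n ≠ 0 := pow_ne_zero _ F.s_pos.ne'
    simp [smul_smul, mul_inv_cancel₀ h]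

/-- The Hutchinson operator `K ↦ ⋃ f_n(K)` on nonempty compact sets. -/
def hutchinson (K : NonemptyCompacts (Euc M)) : NonemptyCompacts (Euc M) where
  carrier := ⋃ n, F.map n '' K
  isCompact' := isCompact_iUnion fun n => K.isCompact.image (by
    change Continuous fun x => F.s ^ F.a n • F.O n x + F.q n
    fun_prop)
  nonempty' := by
    obtain ⟨x, hx⟩ := K.nonempty
    exact ⟨F.map ⟨0, lt_of_lt_of_le two_pos F.two_le⟩ x, Set.mem_iUnion.2 ⟨_, x, hx, rfl⟩⟩

theorem edist_map_le (n : Fin N) (x y : Euc M) :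
    edist (F.map n x) (F.map n y) ≤ ENNReal.ofReal F.s * edist x y := by
  rw [edist_dist, edist_dist, ← ENNReal.ofReal_mul F.s_pos.le]
  refine ENNReal.ofReal_le_ofReal ?_
  change dist (F.s ^ F.a n • F.O n x + F.q n) (F.s ^ F.a n • F.O n y + F.q n) ≤ _
  rw [dist_add_right, dist_smul₀, (F.O n).dist_map, Real.norm_of_nonneg (pow_nonneg F.s_pos.le _)]
  exact mul_le_mul_of_nonneg_right
    (pow_le_of_le_one F.s_pos.le F.s_lt_one.le (F.a_pos n).ne') dist_nonneg

theorem contractingWith_hutchinson : ContractingWith (Real.toNNReal F.s) F.hutchinson := by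
  have key : ∀ (n : Fin N) (K L : Set (Euc M)) (x : Euc M), x ∈ K →
      Metric.infEDist (F.map n x) (F.map n '' L)
        ≤ ENNReal.ofReal F.s * Metric.hausdorffEDist K L := by
    intro n K L x hx
    have h0 : ENNReal.ofReal F.s ≠ 0 := by simpa using F.s_pos
    refine le_trans ?_ (mul_le_mul_right (Metric.infEDist_le_hausdorffEDist_of_mem hx) _)
    rw [Metric.infEDist, Metric.infEDist, ENNReal.mul_iInf_of_ne h0 ENNReal.ofReal_ne_top]
    refine le_iInf fun y => ?_
    rw [ENNReal.mul_iInf_of_ne h0 ENNReal.ofReal_ne_top]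
    refine le_iInf fun hy => ?_
    exact (iInf₂_le _ (Set.mem_image_of_mem _ hy)).trans (F.edist_map_le n x y)
  refine ⟨by rw [← NNReal.coe_lt_coe, Real.coe_toNNReal _ F.s_pos.le]; exact F.s_lt_one, ?_⟩
  intro K L
  change Metric.hausdorffEDist (⋃ n, F.map n '' (K : Set (Euc M)))
    (⋃ n, F.map n '' (L : Set (Euc M))) ≤ ENNReal.ofReal F.s * Metric.hausdorffEDist _ _
  refine Metric.hausdorffEDist_iUnion_le.trans (iSup_le fun n => ?_)
  refine Metric.hausdorffEDist_le_of_infEDist ?_ ?_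
  · rintro _ ⟨x, hx, rfl⟩
    exact key n _ _ x hx
  · rintro _ ⟨x, hx, rfl⟩
    rw [Metric.hausdorffEDist_comm]
    exact key n _ _ x hx

theorem existsUnique_attractor :
    ∃! A : Set (Euc M), A.Nonempty ∧ IsCompact A ∧ A = ⋃ n, F.map n '' A := by
  have hc := F.contractingWith_hutchinson
  refine ⟨(ContractingWith.fixedPoint F.hutchinson hc : NonemptyCompacts (Euc M)),
    ⟨NonemptyCompacts.nonempty _, NonemptyCompacts.isCompact _, ?_⟩, ?_⟩
  · exact congrArg (fun K : NonemptyCompacts (Euc M) => (K : Set (Euc M)))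
      hc.fixedPoint_isFixedPt.symm
  · rintro B ⟨hne, hB, hfix⟩
    have : Function.IsFixedPt F.hutchinson ⟨⟨B, hB⟩, hne⟩ := NonemptyCompacts.ext hfix.symm
    exact congrArg (fun K : NonemptyCompacts (Euc M) => (K : Set (Euc M)))
      (hc.fixedPoint_unique this)

/-- The attractor `A`: the unique nonempty compact set with `A = ⋃ f_n(A)`. -/
noncomputable def attractor : Set (Euc M) := F.existsUnique_attractor.choose

theorem attractor_spec : F.attractor.Nonempty ∧ IsCompact F.attractor ∧
    F.attractor = ⋃ n, F.map n '' F.attractor :=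
  F.existsUnique_attractor.choose_spec.1

theorem eq_attractor {B : Set (Euc M)} (h : B.Nonempty) (hB : IsCompact B)
    (hfix : B = ⋃ n, F.map n '' B) : B = F.attractor :=
  F.existsUnique_attractor.choose_spec.2 B ⟨h, hB, hfix⟩

/-- Tiling iterated function system: the exponents are coprime and distinct pieces `f_i(A)`,
`f_j(A)` are non-overlapping, i.e. meet in a set of smaller Hausdorff dimension than `A`. -/
def IsTIFS : Prop :=
  Finset.univ.gcd F.a = 1 ∧
  ∀ i j, i ≠ j →
    dimH ((F.map i '' F.attractor) ∩ (F.map j '' F.attractor)) < dimH F.attractor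

/-- `ξ(σ) = a_{σ_1} + ⋯ + a_{σ_k}`. -/
def xi (σ : List (Fin N)) : ℕ := (σ.map F.a).sum

/-- `Ω_k`: the words `σ` with `ξ(σ⁻) ≤ k < ξ(σ)`, where `σ⁻` is `σ` without its last letter. -/
def Omega (k : ℕ) : Set (List (Fin N)) := {σ | F.xi σ.dropLast ≤ k ∧ k < F.xi σ}

/-- `f_σ = f_{σ_1} f_{σ_2} ⋯ f_{σ_k}`. -/
noncomputable def word (σ : List (Fin N)) : Equiv.Perm (Euc M) := (σ.map F.map).prod

/-- `f_{-θ} = f_{θ_1}⁻¹ f_{θ_2}⁻¹ ⋯ f_{θ_k}⁻¹`. -/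
noncomputable def negWord (θ : List (Fin N)) : Equiv.Perm (Euc M) := (θ.map fun n => (F.map n)⁻¹).prod

/-- `Π(θ) = {f_{-θ} f_σ(A) : σ ∈ Ω_{ξ(θ)}}` for a finite word `θ`. -/
def finTiling (θ : List (Fin N)) : Set (Set (Euc M)) :=
  {t | ∃ σ ∈ F.Omega (F.xi θ), t = F.negWord θ '' (F.word σ '' F.attractor)}

/-- `Π(θ) = ⋃_{k ≥ 1} Π(θ|k)` for an infinite word `θ`. -/
def tiling (θ : Stream' (Fin N)) : Set (Set (Euc M)) :=
  ⋃ k : ℕ, ⋃ _ : 1 ≤ k, F.finTiling (θ.take k)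

/-- The canonical tiling `T_0 = {f_n(A) : n}` of `A`. -/
def T₀ : Set (Set (Euc M)) := Set.range fun n => F.map n '' F.attractor

/-- The isometries of `ℝ^M` that belong to the group generated by the maps `f_n`. -/
def generatedIsometries : Subgroup (Equiv.Perm (Euc M)) :=
  Subgroup.closure (Set.range F.map) ⊓ euclideanIsometries M

/-- `T_0` and `E T_0` have a tile in common, and their common tiles tile `A ∩ E A`. As in the
definition of non-overlapping tiles, sets of Hausdorff dimension smaller than that of `A` are
disregarded: the common tiles cover `A ∩ E A` up to such a set. -/
def CommonTilesTile (E : Equiv.Perm (Euc M)) : Prop :=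
  (F.T₀ ∩ moveTiling E F.T₀).Nonempty ∧
  dimH ((F.attractor ∩ E '' F.attractor) \ ⋃₀ (F.T₀ ∩ moveTiling E F.T₀)) < dimH F.attractor

/-- Local rigidity with respect to a group `𝒯` of isometries: (i) the only `E ∈ 𝒯` such that
`T_0 ∩ E T_0` tiles `A ∩ E A` is the identity; (ii) the only symmetry of `A` among the isometries
of the form `f_{-θ} f_σ` is the identity. -/
def IsLocallyRigid (𝒯 : Subgroup (Equiv.Perm (Euc M))) : Prop :=
  (∀ E ∈ 𝒯, F.CommonTilesTile E → E = 1) ∧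
  (∀ θ σ : List (Fin N), F.negWord θ * F.word σ ∈ euclideanIsometries M →
    (F.negWord θ * F.word σ : Equiv.Perm (Euc M)) '' F.attractor = F.attractor →
    F.negWord θ * F.word σ = 1)

theorem xi_append (σ τ : List (Fin N)) : F.xi (σ ++ τ) = F.xi σ + F.xi τ := by
  simp [xi]

theorem xi_take_add (θ : Stream' (Fin N)) (p k : ℕ) :
    F.xi (θ.take (p + k)) = F.xi (θ.take p) + F.xi ((θ.drop p).take k) := by
  rw [← xi_append, Stream'.take_add]

/-- `θ ∼ ψ` iff `ξ(θ|p) = ξ(ψ|q)` and `S^p θ = S^q ψ` for some `p`, `q`, where `S` is the shift.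
(Since `p` and `q` may be increased by one, it does not matter whether zero is allowed.) -/
def addressSetoid : Setoid (Stream' (Fin N)) where
  r θ ψ := ∃ p q : ℕ, F.xi (θ.take p) = F.xi (ψ.take q) ∧ θ.drop p = ψ.drop q
  iseqv :=
    { refl := fun _ => ⟨0, 0, rfl, rfl⟩
      symm := fun ⟨p, q, h, h'⟩ => ⟨q, p, h.symm, h'.symm⟩
      trans := by
        rintro θ ψ χ ⟨p, q, h, h'⟩ ⟨r, t, k, k'⟩
        refine ⟨p + r, t + q, ?_, ?_⟩
        · rw [xi_take_add, xi_take_add, h, h', ← k, ← k', ← xi_take_add, ← xi_take_add,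
            Nat.add_comm]
        · rw [Nat.add_comm p r, Nat.add_comm t q, ← Stream'.drop_drop, ← Stream'.drop_drop] at *
          rw [Stream'.drop_drop, Stream'.drop_drop, Nat.add_comm r p, Nat.add_comm q t,
            ← Stream'.drop_drop, ← Stream'.drop_drop, h', ← k', Stream'.drop_drop,
            Stream'.drop_drop, Nat.add_comm] }

/-- The space `Σ̃` of equivalence classes of infinite (reversed) addresses, with the discrete
topology. -/
def AddressSpace : Type := Quotient F.addressSetoid

instance : TopologicalSpace F.AddressSpace := ⊥

instance : DiscreteTopology F.AddressSpace := ⟨rfl⟩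

/-- The class `[θ]`. -/
def addressClass (θ : Stream' (Fin N)) : F.AddressSpace := Quotient.mk F.addressSetoid θ

/-- The set `𝕋_∞ = {Π(θ) : θ an infinite address}` of tilings. -/
def InfTilings : Type := Set.range F.tiling

theorem moveTiling_mul (E E' : Equiv.Perm (Euc M)) (T : Set (Set (Euc M))) :
    moveTiling (E * E') T = moveTiling E (moveTiling E' T) := by
  simp only [moveTiling, Set.image_image]
  rfl

theorem moveTiling_one (T : Set (Set (Euc M))) : moveTiling 1 T = T := by
  simp [moveTiling]

/-- Tilings `X`, `Y` in `𝕋_∞` are equivalent iff `E₁ X = E₂ Y` for some `E₁, E₂ ∈ 𝒯`. -/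
def tilingSetoid (𝒯 : Subgroup (Equiv.Perm (Euc M))) : Setoid F.InfTilings where
  r X Y := ∃ E₁ ∈ 𝒯, ∃ E₂ ∈ 𝒯, moveTiling E₁ X.1 = moveTiling E₂ Y.1
  iseqv :=
    { refl := fun _ => ⟨1, 𝒯.one_mem, 1, 𝒯.one_mem, rfl⟩
      symm := fun ⟨E₁, h₁, E₂, h₂, h⟩ => ⟨E₂, h₂, E₁, h₁, h.symm⟩
      trans := by
        rintro X Y Z ⟨E₁, h₁, E₂, h₂, h⟩ ⟨E₃, h₃, E₄, h₄, h'⟩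
        refine ⟨E₃ * E₂⁻¹ * E₁, 𝒯.mul_mem (𝒯.mul_mem h₃ (𝒯.inv_mem h₂)) h₁, E₄, h₄, ?_⟩
        rw [moveTiling_mul, h, ← moveTiling_mul, inv_mul_cancel_right, h'] }

/-- The tiling space `𝕋̃ = 𝕋_∞/∼`, with the discrete topology. -/
def TilingSpace (𝒯 : Subgroup (Equiv.Perm (Euc M))) : Type := Quotient (F.tilingSetoid 𝒯)

instance (𝒯 : Subgroup (Equiv.Perm (Euc M))) : TopologicalSpace (F.TilingSpace 𝒯) := ⊥

instance (𝒯 : Subgroup (Equiv.Perm (Euc M))) : DiscreteTopology (F.TilingSpace 𝒯) := ⟨rfl⟩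

/-- The class `[Π(θ)]`. -/
def tilingClass (𝒯 : Subgroup (Equiv.Perm (Euc M))) (θ : Stream' (Fin N)) : F.TilingSpace 𝒯 :=
  Quotient.mk (F.tilingSetoid 𝒯) ⟨F.tiling θ, θ, rfl⟩

end SimilitudeIFS

/-!
The heart of the matter is that `Π̃` is injective; the rest is bookkeeping with the function `ξ`.

**The modified shift.** `TailRel d θ ψ` says that `θ` and `ψ` have a common tail, and that `ξ` of the
prefix of `θ` before it exceeds `ξ` of the prefix of `ψ` by `d`. These relations compose additively
(`TailRel.trans`), `TailRel 0` is equivalence of addresses, and `TailRel d` is total because all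
large integers are values of `ξ` when the exponents are coprime. Hence `TailRel 1` and `TailRel (-1)`
induce mutually inverse maps of the address space. As all spaces are discrete, bijections are
homeomorphisms, and `α̃` is the conjugate of `S̃` by `Π̃`.

**The hierarchy.** `Π(θ)` is the level `0` of a hierarchy of tilings (`levelTiling`): level `j + 1`
arises from level `j` by merging certain families `h T₀` into single tiles `h(A)`, where `h` is one of
the maps `f_{-θ|k} f_σ` with scaling factor `s ^ (-j)` (`IsBlock`). Distinct tiles of one level do
not overlap.

**Recognizability.** Let `h T₀` consist of tiles of level `j` of `Π(ψ)`, where `h` scales by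
`s ^ (-j)`. Its smallest tile is as small as tiles of this level can be, so it was cut from a tile
`g(A)` of level `j + 1`. Then `T₀` and `g⁻¹ h T₀` have a tile in common, and since their other tiles
do not overlap, the common ones tile the intersection. Local rigidity gives `h = g`
(`IsTIFS.isBlock_of_subset`). Consequently equal tilings have equal hierarchies
(`IsTIFS.levelTiling_eq`), and `Π` is injective (`IsTIFS.tiling_injective`): each `f_{-θ|k}` occurs
in the hierarchy of `Π(θ)`, and non-overlap turns an equality of maps `f_{-θ|k} = f_{-ψ|l} f_σ` into
an equality of words.

If `E Π(θ) = Π(ψ)` with `E ∈ 𝒯`, recognizability at level `0`, applied to `E T₀`, shows that `E` is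
one of the maps `f_{-ψ|k} f_σ` with `ξ(σ) = ξ(ψ|k)`. Exchanging the prefix `ψ|k` for the reversal of
`σ` therefore absorbs `E`, which reduces the claim to the injectivity of `Π`. -/

namespace SimilitudeIFS

variable {M N : ℕ} (F : SimilitudeIFS M N)

/-! ### Lengths of words -/

theorem take_length_append {α : Type*} (w : List α) (θ : Stream' α) :
    (w ++ₛ θ).take w.length = w := by
  simpa using (Stream'.append_take (x := w) (a := θ) 0).symm

@[simp] theorem xi_nil : F.xi [] = 0 := rfl

@[simp] theorem xi_cons (n : Fin N) (σ : List (Fin N)) : F.xi (n :: σ) = F.a n + F.xi σ := by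
  simp [xi]

@[simp] theorem xi_reverse (σ : List (Fin N)) : F.xi σ.reverse = F.xi σ := by
  simp [xi, List.sum_reverse]

theorem length_le_xi (σ : List (Fin N)) : σ.length ≤ F.xi σ := by
  induction σ with
  | nil => simp
  | cons n σ ih => have := F.a_pos n; simp; omega

theorem le_xi_take (θ : Stream' (Fin N)) (j : ℕ) : j ≤ F.xi (θ.take j) := by
  simpa using F.length_le_xi (θ.take j)

theorem exists_xi_eq_of_mem_closure {m : ℕ} (hm : m ∈ AddSubmonoid.closure (Set.range F.a)) :
    ∃ w, F.xi w = m := by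
  induction hm using AddSubmonoid.closure_induction with
  | mem x hx =>
    obtain ⟨n, rfl⟩ := hx
    exact ⟨[n], by simp⟩
  | zero => exact ⟨[], rfl⟩
  | add x y _ _ hx hy =>
    obtain ⟨v, rfl⟩ := hx
    obtain ⟨w, rfl⟩ := hy
    exact ⟨v ++ w, F.xi_append v w⟩

/-- As the exponents are coprime, they generate a numerical semigroup. -/
theorem exists_forall_ge_exists_xi_eq (hgcd : Finset.univ.gcd F.a = 1) :
    ∃ n, ∀ m ≥ n, ∃ w, F.xi w = m := by
  obtain ⟨n, hn⟩ := Nat.exists_mem_closure_of_ge (Set.range F.a)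
  refine ⟨n, fun m hm => F.exists_xi_eq_of_mem_closure (hn m hm ?_)⟩
  refine dvd_trans ?_ (one_dvd m)
  rw [← hgcd]
  exact Finset.dvd_gcd fun i _ => Nat.setGcd_dvd_of_mem ⟨i, rfl⟩

/-! ### The modified shift -/

/-- `θ` and `ψ` have a common tail, which starts in `θ` at a place where `ξ` is larger by `d`
than at the place where it starts in `ψ`. For `d = 0` this is the equivalence of addresses, and
for `d = 1` the graph of the modified shift. -/
def TailRel (d : ℤ) (θ ψ : Stream' (Fin N)) : Prop :=
  ∃ p q : ℕ, (F.xi (θ.take p) : ℤ) = F.xi (ψ.take q) + d ∧ θ.drop p = ψ.drop q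

variable {F}

theorem TailRel.symm {d : ℤ} {θ ψ : Stream' (Fin N)} (h : F.TailRel d θ ψ) :
    F.TailRel (-d) ψ θ := by
  obtain ⟨p, q, h, h'⟩ := h
  exact ⟨q, p, by omega, h'.symm⟩

theorem TailRel.trans {d e : ℤ} {θ ψ χ : Stream' (Fin N)} (h : F.TailRel d θ ψ)
    (k : F.TailRel e ψ χ) : F.TailRel (d + e) θ χ := by
  obtain ⟨p, q, h, h'⟩ := h
  obtain ⟨r, t, k, k'⟩ := k
  refine ⟨p + r, t + q, ?_, ?_⟩
  · have h1 := F.xi_take_add ψ q r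
    have h2 := F.xi_take_add ψ r q
    rw [Nat.add_comm r q] at h2
    rw [xi_take_add, xi_take_add, h', ← k']
    push_cast
    omega
  · rw [← Stream'.drop_drop, ← Stream'.drop_drop, h', ← k', Stream'.drop_drop, Stream'.drop_drop,
      Nat.add_comm]

variable (F)

theorem addressClass_eq_iff {θ ψ : Stream' (Fin N)} :
    F.addressClass θ = F.addressClass ψ ↔ F.TailRel 0 θ ψ := by
  refine Quotient.eq.trans ⟨?_, ?_⟩
  · rintro ⟨p, q, h, h'⟩
    exact ⟨p, q, by omega, h'⟩
  · rintro ⟨p, q, h, h'⟩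
    exact ⟨p, q, by omega, h'⟩

theorem tailRel_append {d : ℤ} (θ : Stream' (Fin N)) (j : ℕ) (w : List (Fin N))
    (h : (F.xi (θ.take j) : ℤ) = F.xi w + d) : F.TailRel d θ (w ++ₛ θ.drop j) := by
  refine ⟨j, w.length, ?_, (Stream'.drop_append_stream _ _).symm⟩
  rw [take_length_append, h]

theorem exists_tailRel (hgcd : Finset.univ.gcd F.a = 1) (d : ℤ) (θ : Stream' (Fin N)) :
    ∃ ψ, F.TailRel d θ ψ := by
  obtain ⟨n, hn⟩ := F.exists_forall_ge_exists_xi_eq hgcd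
  have hj := F.le_xi_take θ (n + d.natAbs)
  obtain ⟨w, hw⟩ := hn ((F.xi (θ.take (n + d.natAbs)) : ℤ) - d).toNat (by omega)
  exact ⟨_, F.tailRel_append θ (n + d.natAbs) w (by omega)⟩

theorem addressClass_surjective : Function.Surjective F.addressClass := Quotient.mk_surjective

/-- The map of the address space that sends `[θ]` to `[ψ]` whenever `F.TailRel d θ ψ`. -/
noncomputable def shiftBy (hgcd : Finset.univ.gcd F.a = 1) (d : ℤ) (c : F.AddressSpace) :
    F.AddressSpace :=
  F.addressClass (F.exists_tailRel hgcd d (F.addressClass_surjective c).choose).choose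

theorem shiftBy_addressClass (hgcd : Finset.univ.gcd F.a = 1) {d : ℤ} {θ ψ : Stream' (Fin N)}
    (h : F.TailRel d θ ψ) : F.shiftBy hgcd d (F.addressClass θ) = F.addressClass ψ := by
  have h₁ := F.addressClass_eq_iff.1 (F.addressClass_surjective (F.addressClass θ)).choose_spec
  have h₂ := (F.exists_tailRel hgcd d
    (F.addressClass_surjective (F.addressClass θ)).choose).choose_spec
  refine F.addressClass_eq_iff.2 ?_
  have := (h₂.symm.trans h₁).trans h
  rwa [show -d + 0 + d = 0 by ring] at this

theorem shiftBy_neg_shiftBy (hgcd : Finset.univ.gcd F.a = 1) (d : ℤ) (c : F.AddressSpace) :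
    F.shiftBy hgcd (-d) (F.shiftBy hgcd d c) = c := by
  obtain ⟨θ, rfl⟩ := F.addressClass_surjective c
  obtain ⟨ψ, h⟩ := F.exists_tailRel hgcd d θ
  rw [F.shiftBy_addressClass hgcd h, F.shiftBy_addressClass hgcd h.symm]

/-- The modified shift `S̃`, which lowers `ξ` of a prefix by one. -/
noncomputable def modifiedShift (hgcd : Finset.univ.gcd F.a = 1) :
    F.AddressSpace ≃ₜ F.AddressSpace where
  toFun := F.shiftBy hgcd 1
  invFun := F.shiftBy hgcd (-1)
  left_inv := F.shiftBy_neg_shiftBy hgcd 1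
  right_inv := F.shiftBy_neg_shiftBy hgcd (-1)
  continuous_toFun := continuous_of_discreteTopology
  continuous_invFun := continuous_of_discreteTopology

/-! ### Scaling factors -/

/-- `g` multiplies all distances by `s ^ z`. -/
def HasScale (g : Equiv.Perm (Euc M)) (z : ℤ) : Prop :=
  ∀ x y, dist (g x) (g y) = F.s ^ z * dist x y

variable {F}

theorem HasScale.mul {g h : Equiv.Perm (Euc M)} {z w : ℤ} (hg : F.HasScale g z)
    (hh : F.HasScale h w) : F.HasScale (g * h) (z + w) := fun x y => by
  rw [Equiv.Perm.mul_apply, Equiv.Perm.mul_apply, hg, hh, zpow_add₀ F.s_pos.ne', mul_assoc]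

theorem HasScale.inv {g : Equiv.Perm (Euc M)} {z : ℤ} (hg : F.HasScale g z) :
    F.HasScale g⁻¹ (-z) := fun x y => by
  have h := hg (g⁻¹ x) (g⁻¹ y)
  rw [show g (g⁻¹ x) = x from g.apply_symm_apply x,
    show g (g⁻¹ y) = y from g.apply_symm_apply y] at h
  rw [h, ← mul_assoc, ← zpow_add₀ F.s_pos.ne', neg_add_cancel, zpow_zero, one_mul]

variable (F)

theorem hasScale_one : F.HasScale 1 0 := fun x y => by simp

theorem hasScale_zero_iff {g : Equiv.Perm (Euc M)} :
    F.HasScale g 0 ↔ g ∈ euclideanIsometries M := by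
  change _ ↔ Isometry g
  simp [HasScale, isometry_iff_dist_eq]

theorem hasScale_map (n : Fin N) : F.HasScale (F.map n) (F.a n) := fun x y => by
  change dist (F.s ^ F.a n • F.O n x + F.q n) (F.s ^ F.a n • F.O n y + F.q n) = _
  rw [dist_add_right, dist_smul₀, (F.O n).dist_map, Real.norm_of_nonneg (pow_nonneg F.s_pos.le _),
    zpow_natCast]

@[simp] theorem word_nil : F.word [] = 1 := rfl

@[simp] theorem word_cons (n : Fin N) (σ : List (Fin N)) :
    F.word (n :: σ) = F.map n * F.word σ := by simp [word]

@[simp] theorem word_append (σ τ : List (Fin N)) :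
    F.word (σ ++ τ) = F.word σ * F.word τ := by simp [word]

theorem negWord_eq (σ : List (Fin N)) : F.negWord σ = (F.word σ.reverse)⁻¹ := by
  simp [negWord, word, List.prod_inv_reverse, List.map_reverse, Function.comp_def]

theorem negWord_append (σ τ : List (Fin N)) :
    F.negWord (σ ++ τ) = F.negWord σ * F.negWord τ := by simp [negWord]

theorem hasScale_word (σ : List (Fin N)) : F.HasScale (F.word σ) (F.xi σ) := by
  induction σ with
  | nil => exact F.hasScale_one
  | cons n σ ih =>
    rw [word_cons, xi_cons, Nat.cast_add]
    exact (F.hasScale_map n).mul ih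

theorem hasScale_negWord (σ : List (Fin N)) : F.HasScale (F.negWord σ) (-F.xi σ) := by
  rw [negWord_eq, ← xi_reverse]
  exact (F.hasScale_word _).inv

theorem word_mem_closure (σ : List (Fin N)) :
    F.word σ ∈ Subgroup.closure (Set.range F.map) := by
  refine Subgroup.list_prod_mem _ fun x hx => ?_
  obtain ⟨n, -, rfl⟩ := List.mem_map.1 hx
  exact Subgroup.subset_closure ⟨n, rfl⟩

theorem negWord_mem_closure (σ : List (Fin N)) :
    F.negWord σ ∈ Subgroup.closure (Set.range F.map) := by
  rw [negWord_eq]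
  exact inv_mem (F.word_mem_closure _)

variable {F}

theorem HasScale.dimH_image {g : Equiv.Perm (Euc M)} {z : ℤ} (hg : F.HasScale g z)
    (K : Set (Euc M)) : dimH (g '' K) = dimH K := by
  have key : ∀ (h : Equiv.Perm (Euc M)) (w : ℤ), F.HasScale h w →
      ∀ L : Set (Euc M), dimH (h '' L) ≤ dimH L := fun h w hh L =>
    (LipschitzWith.of_dist_le_mul (K := ⟨F.s ^ w, (zpow_pos F.s_pos w).le⟩)
      fun x y => (hh x y).le).dimH_image_le L
  refine le_antisymm (key g z hg K) ?_
  have := key g⁻¹ _ hg.inv (g '' K)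
  rwa [Equiv.Perm.inv_def, Equiv.symm_image_image] at this

theorem HasScale.ediam_image {g : Equiv.Perm (Euc M)} {z : ℤ} (hg : F.HasScale g z)
    (K : Set (Euc M)) : Metric.ediam (g '' K) = ENNReal.ofReal (F.s ^ z) * Metric.ediam K := by
  have key : ∀ (h : Equiv.Perm (Euc M)) (w : ℤ), F.HasScale h w →
      ∀ L : Set (Euc M), Metric.ediam (h '' L) ≤ ENNReal.ofReal (F.s ^ w) * Metric.ediam L := by
    intro h w hh L
    exact (LipschitzWith.of_dist_le_mul (K := (F.s ^ w).toNNReal)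
      fun x y => by
        rw [Real.coe_toNNReal _ (zpow_pos F.s_pos w).le]; exact (hh x y).le).ediam_image_le L
  refine le_antisymm (key g z hg K) ?_
  have := key g⁻¹ _ hg.inv (g '' K)
  rw [Equiv.Perm.inv_def, Equiv.symm_image_image] at this
  refine (mul_le_mul_right this _).trans_eq ?_
  rw [← mul_assoc, ← ENNReal.ofReal_mul (zpow_pos F.s_pos z).le, ← zpow_add₀ F.s_pos.ne',
    add_neg_cancel, zpow_zero, ENNReal.ofReal_one, one_mul]

variable (F)

/-! ### Pieces of the attractor -/

theorem map_image_attractor_subset (n : Fin N) : F.map n '' F.attractor ⊆ F.attractor := by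
  conv_rhs => rw [F.attractor_spec.2.2]
  exact Set.subset_iUnion (fun n => F.map n '' F.attractor) n

theorem word_image_attractor_subset (σ : List (Fin N)) :
    F.word σ '' F.attractor ⊆ F.attractor := by
  induction σ with
  | nil => simp
  | cons n σ ih =>
    rw [word_cons, Equiv.Perm.coe_mul, Set.image_comp]
    exact (Set.image_mono ih).trans (F.map_image_attractor_subset n)

variable {F}

theorem IsTIFS.dimH_pos (hF : F.IsTIFS) : 0 < dimH F.attractor := by
  have h2 := F.two_le
  exact (zero_le).trans_lt (hF.2 ⟨0, by omega⟩ ⟨1, by omega⟩ (by simp))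

/-- The scaling factor of a similitude is determined by the image of the attractor. -/
theorem IsTIFS.scale_eq (hF : F.IsTIFS) {g h : Equiv.Perm (Euc M)} {z w : ℤ}
    (hg : F.HasScale g z) (hh : F.HasScale h w)
    (heq : g '' F.attractor = h '' F.attractor) : z = w := by
  have hpos : Metric.ediam F.attractor ≠ 0 := by
    intro h0
    exact hF.dimH_pos.ne' (dimH_subsingleton (Metric.ediam_eq_zero_iff.1 h0))
  have hfin : Metric.ediam F.attractor ≠ ⊤ := F.attractor_spec.2.1.isBounded.ediam_ne_top
  have hd := hg.ediam_image F.attractor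
  rw [heq, hh.ediam_image, ENNReal.mul_left_inj hpos hfin,
    ENNReal.ofReal_eq_ofReal_iff (zpow_pos F.s_pos _).le (zpow_pos F.s_pos _).le] at hd
  exact (zpow_right_injective₀ F.s_pos F.s_lt_one.ne hd).symm

theorem IsTIFS.dimH_word_inter_lt (hF : F.IsTIFS) {σ τ : List (Fin N)} (h : ¬ σ <+: τ)
    (h' : ¬ τ <+: σ) :
    dimH (F.word σ '' F.attractor ∩ F.word τ '' F.attractor) < dimH F.attractor := by
  induction σ generalizing τ with
  | nil => exact absurd List.nil_prefix h
  | cons i σ ih =>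
    cases τ with
    | nil => exact absurd List.nil_prefix h'
    | cons j τ =>
      rw [word_cons, word_cons, Equiv.Perm.coe_mul, Equiv.Perm.coe_mul, Set.image_comp,
        Set.image_comp]
      by_cases hij : i = j
      · subst hij
        rw [← Set.image_inter (F.map i).injective, (F.hasScale_map i).dimH_image]
        exact ih (by simpa [List.cons_prefix_cons] using h)
          (by simpa [List.cons_prefix_cons] using h')
      · exact (dimH_mono (Set.inter_subset_inter
          (Set.image_mono (F.word_image_attractor_subset σ))
          (Set.image_mono (F.word_image_attractor_subset τ)))).trans_lt (hF.2 i j hij)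

/-- Words with the same value of `ξ` that define the same map are equal. -/
theorem IsTIFS.word_injective (hF : F.IsTIFS) {σ τ : List (Fin N)} (hw : F.word σ = F.word τ) :
    σ = τ := by
  have hxi : F.xi σ = F.xi τ := by
    have := hF.scale_eq (F.hasScale_word σ) (F.hasScale_word τ) (by rw [hw])
    exact_mod_cast this
  have key : ∀ {α β : List (Fin N)}, F.xi α = F.xi β → α <+: β → α = β := by
    rintro α _ hx ⟨γ, rfl⟩
    have h0 := F.length_le_xi γ
    rw [xi_append] at hx
    have : γ = [] := List.length_eq_zero_iff.1 (by omega)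
    simp [this]
  by_contra hne
  have := hF.dimH_word_inter_lt (fun h => hne (key hxi h)) (fun h => hne (key hxi.symm h).symm)
  rw [hw, Set.inter_self, (F.hasScale_word τ).dimH_image] at this
  exact this.false

variable (F)

/-! ### The hierarchy of a tiling -/

/-- The tiling of level `j` in the hierarchy of `Π(θ)`: it consists of the sets `f_{-θ|k} f_σ(A)`
where `ξ(σ⁻) ≤ ξ(θ|k) - j < ξ(σ)`. All its tiles are copies of `A` scaled by at most `s ^ (1 - j)`.
The condition is written without subtraction; it forces `σ` to be nonempty and `j ≤ ξ(θ|k)`, so the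
short prefixes of `θ` contribute nothing. -/
def levelTiling (j : ℕ) (θ : Stream' (Fin N)) : Set (Set (Euc M)) :=
  {t | ∃ k σ, F.xi σ.dropLast + j ≤ F.xi (θ.take k) ∧ F.xi (θ.take k) < F.xi σ + j ∧
    t = (F.negWord (θ.take k) * F.word σ) '' F.attractor}

/-- `h` is one of the maps `f_{-θ|k} f_σ` with scaling factor `s ^ (-j)`. The set `h(A)` is then a
tile of level `j + 1` which is divided into the tiles `h f_n(A)` of level `j`. -/
def IsBlock (j : ℕ) (θ : Stream' (Fin N)) (h : Equiv.Perm (Euc M)) : Prop :=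
  ∃ k σ, F.xi σ + j = F.xi (θ.take k) ∧ h = F.negWord (θ.take k) * F.word σ

theorem xi_dropLast_lt {σ : List (Fin N)} (h : σ ≠ []) : F.xi σ.dropLast < F.xi σ := by
  conv_rhs => rw [← List.dropLast_append_getLast h]
  have := F.a_pos (σ.getLast h)
  rw [xi_append]
  simp
  omega

/-- The prefix `θ|k` in `f_{-θ|k} f_σ` can be lengthened. -/
theorem exists_lift (θ : Stream' (Fin N)) {k k' : ℕ} (hk : k ≤ k') :
    ∃ τ, F.xi (θ.take k') = F.xi τ + F.xi (θ.take k) ∧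
      ∀ σ, F.negWord (θ.take k') * F.word (τ ++ σ) = F.negWord (θ.take k) * F.word σ := by
  obtain ⟨d, rfl⟩ := Nat.exists_eq_add_of_le hk
  refine ⟨((θ.drop k).take d).reverse, ?_, fun σ => ?_⟩
  · rw [xi_take_add, xi_reverse, Nat.add_comm]
  · rw [Stream'.take_add, negWord_append, word_append, F.negWord_eq ((θ.drop k).take d)]
    group

/-- A tile can be written with any sufficiently long prefix of `θ`. -/
theorem levelTiling_lift {j : ℕ} {θ : Stream' (Fin N)} {k : ℕ} {σ : List (Fin N)}
    (h₁ : F.xi σ.dropLast + j ≤ F.xi (θ.take k)) (h₂ : F.xi (θ.take k) < F.xi σ + j) {k' : ℕ}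
    (hk : k ≤ k') :
    ∃ σ', F.xi σ'.dropLast + j ≤ F.xi (θ.take k') ∧ F.xi (θ.take k') < F.xi σ' + j ∧
      F.negWord (θ.take k') * F.word σ' = F.negWord (θ.take k) * F.word σ := by
  obtain ⟨τ, hτ, hlift⟩ := F.exists_lift θ hk
  have hσ : σ ≠ [] := by
    rintro rfl
    simp at h₁ h₂
    omega
  refine ⟨τ ++ σ, ?_, ?_, hlift σ⟩
  · rw [List.dropLast_append_of_ne_nil hσ, xi_append]
    omega
  · rw [xi_append]
    omega

theorem tiling_eq_levelTiling (θ : Stream' (Fin N)) : F.tiling θ = F.levelTiling 0 θ := by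
  ext t
  simp only [tiling, finTiling, Omega, Set.mem_iUnion, Set.mem_ofPred_eq, levelTiling]
  constructor
  · rintro ⟨k, -, σ, ⟨h₁, h₂⟩, rfl⟩
    exact ⟨k, σ, h₁, h₂, by rw [Equiv.Perm.coe_mul, Set.image_comp]⟩
  · rintro ⟨k, σ, h₁, h₂, rfl⟩
    obtain ⟨σ', h₁', h₂', he⟩ := F.levelTiling_lift h₁ h₂ (Nat.le_succ k)
    exact ⟨k + 1, by omega, σ', ⟨h₁', h₂'⟩, by
      rw [← Set.image_comp, ← Equiv.Perm.coe_mul, he]⟩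

/-- Distinct tiles of the same level do not overlap. -/
theorem IsTIFS.dimH_inter_lt {F : SimilitudeIFS M N} (hF : F.IsTIFS) {j : ℕ}
    {θ : Stream' (Fin N)} {t u : Set (Euc M)} (ht : t ∈ F.levelTiling j θ)
    (hu : u ∈ F.levelTiling j θ) (hne : t ≠ u) : dimH (t ∩ u) < dimH F.attractor := by
  obtain ⟨k, σ, h₁, h₂, rfl⟩ := ht
  obtain ⟨l, τ, h₃, h₄, rfl⟩ := hu
  obtain ⟨σ, h₁, h₂, he⟩ := F.levelTiling_lift h₁ h₂ (le_max_left k l)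
  obtain ⟨τ, h₃, h₄, he'⟩ := F.levelTiling_lift h₃ h₄ (le_max_right k l)
  rw [← he, ← he'] at hne ⊢
  have key : ∀ {α β : List (Fin N)} {m : ℕ}, m < F.xi α + j → F.xi β.dropLast + j ≤ m →
      α <+: β → α = β := by
    rintro α _ m hα hβ ⟨γ, rfl⟩
    by_contra h0
    have hγ : γ ≠ [] := by rintro rfl; simp at h0
    rw [List.dropLast_append_of_ne_nil hγ, xi_append] at hβ
    omega
  have hστ : σ ≠ τ := by rintro rfl; exact hne rfl
  simp only [Equiv.Perm.coe_mul, Set.image_comp]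
  rw [← Set.image_inter (F.negWord _).injective, (F.hasScale_negWord _).dimH_image]
  exact hF.dimH_word_inter_lt (fun h => hστ (key h₂ h₃ h)) (fun h => hστ (key h₄ h₁ h).symm)

variable {F}

theorem IsBlock.hasScale {j : ℕ} {θ : Stream' (Fin N)} {h : Equiv.Perm (Euc M)}
    (hh : F.IsBlock j θ h) : F.HasScale h (-j) := by
  obtain ⟨k, σ, hk, rfl⟩ := hh
  convert (F.hasScale_negWord (θ.take k)).mul (F.hasScale_word σ) using 1
  omega

theorem IsBlock.mem_closure {j : ℕ} {θ : Stream' (Fin N)} {h : Equiv.Perm (Euc M)}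
    (hh : F.IsBlock j θ h) : h ∈ Subgroup.closure (Set.range F.map) := by
  obtain ⟨k, σ, hk, rfl⟩ := hh
  exact mul_mem (F.negWord_mem_closure _) (F.word_mem_closure _)

theorem IsBlock.image_map_mem {j : ℕ} {θ : Stream' (Fin N)} {h : Equiv.Perm (Euc M)}
    (hh : F.IsBlock j θ h) (n : Fin N) :
    h '' (F.map n '' F.attractor) ∈ F.levelTiling j θ := by
  obtain ⟨k, σ, hk, rfl⟩ := hh
  have := F.a_pos n
  refine ⟨k, σ ++ [n], ?_, ?_, ?_⟩
  · rw [List.dropLast_concat]; omega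
  · rw [xi_append, xi_cons, xi_nil]; omega
  · rw [← Set.image_comp, ← Equiv.Perm.coe_mul, mul_assoc]
    simp

theorem IsBlock.image_mem {j : ℕ} {θ : Stream' (Fin N)} {h : Equiv.Perm (Euc M)}
    (hh : F.IsBlock j θ h) : h '' F.attractor ∈ F.levelTiling (j + 1) θ := by
  obtain ⟨k, σ, hk, rfl⟩ := hh
  -- lengthening the prefix once makes the word nonempty
  obtain ⟨τ, hτ, hlift⟩ := F.exists_lift θ (Nat.le_succ k)
  have hne : τ ++ σ ≠ [] := by
    intro h0
    obtain ⟨rfl, rfl⟩ := List.append_eq_nil_iff.1 h0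
    rw [Stream'.take_succ', xi_append] at hτ
    have := F.a_pos (θ.get k)
    simp at hτ
    omega
  have hlt := F.xi_dropLast_lt hne
  rw [F.xi_append τ σ] at hlt
  refine ⟨k + 1, τ ++ σ, ?_, ?_, by rw [hlift σ]⟩
  · change _ ≤ F.xi (θ.take k.succ)
    omega
  · change F.xi (θ.take k.succ) < _
    rw [xi_append]
    omega

theorem mem_levelTiling_succ {j : ℕ} {θ : Stream' (Fin N)} {t : Set (Euc M)}
    (ht : t ∈ F.levelTiling (j + 1) θ) :
    t ∈ F.levelTiling j θ ∨ ∃ h, F.IsBlock j θ h ∧ t = h '' F.attractor := by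
  obtain ⟨k, σ, h₁, h₂, rfl⟩ := ht
  rcases Nat.lt_or_ge (F.xi (θ.take k)) (F.xi σ + j) with h | h
  · exact Or.inl ⟨k, σ, by omega, h, rfl⟩
  · exact Or.inr ⟨_, ⟨k, σ, by omega, rfl⟩, rfl⟩

theorem mem_levelTiling {j : ℕ} {θ : Stream' (Fin N)} {t : Set (Euc M)}
    (ht : t ∈ F.levelTiling j θ) :
    t ∈ F.levelTiling (j + 1) θ ∨
      ∃ h n, F.IsBlock j θ h ∧ t = h '' (F.map n '' F.attractor) := by
  obtain ⟨k, σ, h₁, h₂, rfl⟩ := ht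
  rcases Nat.lt_or_ge (F.xi σ.dropLast + j) (F.xi (θ.take k)) with h | h
  · exact Or.inl ⟨k, σ, by omega, by omega, rfl⟩
  · have hσ : σ ≠ [] := by
      rintro rfl
      simp at h h₂
      omega
    refine Or.inr ⟨F.negWord (θ.take k) * F.word σ.dropLast, σ.getLast hσ,
      ⟨k, _, by omega, rfl⟩, ?_⟩
    rw [← Set.image_comp, ← Equiv.Perm.coe_mul, mul_assoc]
    conv_lhs => rw [← List.dropLast_append_getLast hσ]
    simp

/-! ### Recognizability -/

/-- A tile of level `j` whose scaling exponent is the largest possible one was obtained by dividing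
a tile of level `j + 1`. -/
theorem IsTIFS.exists_isBlock_of_forall_le (hF : F.IsTIFS) {j : ℕ} {ψ : Stream' (Fin N)}
    {h : Equiv.Perm (Euc M)} (hh : F.HasScale h (-j)) {n : Fin N} (hn : ∀ m, F.a m ≤ F.a n)
    (ht : h '' (F.map n '' F.attractor) ∈ F.levelTiling j ψ) :
    ∃ g m, F.IsBlock j ψ g ∧
      h '' (F.map n '' F.attractor) = g '' (F.map m '' F.attractor) := by
  obtain ⟨k, σ, h₁, h₂, he⟩ := ht
  have hσ : σ ≠ [] := by
    rintro rfl
    simp at h₁ h₂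
    omega
  have hx : F.xi σ = F.xi σ.dropLast + F.a (σ.getLast hσ) := by
    conv_lhs => rw [← List.dropLast_append_getLast hσ]
    rw [xi_append]
    simp
  have hz := hF.scale_eq (hh.mul (F.hasScale_map n))
    ((F.hasScale_negWord (ψ.take k)).mul (F.hasScale_word σ))
    (by rw [← he, Equiv.Perm.coe_mul, Set.image_comp])
  have hm := hn (σ.getLast hσ)
  refine ⟨F.negWord (ψ.take k) * F.word σ.dropLast, σ.getLast hσ, ⟨k, _, by omega, rfl⟩, ?_⟩
  symm
  rw [he, ← Set.image_comp, ← Equiv.Perm.coe_mul, mul_assoc]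
  conv_rhs => rw [← List.dropLast_append_getLast hσ]
  simp

/-- If the pieces `f_n(A)` and `E f_m(A)` can only overlap when they are equal, then the common
tiles of `T₀` and `E T₀` cover `A ∩ E A` up to a set of smaller dimension. -/
theorem IsTIFS.commonTilesTile (hF : F.IsTIFS) {E : Equiv.Perm (Euc M)} {n m : Fin N}
    (hnm : F.map m '' F.attractor = E '' (F.map n '' F.attractor))
    (hE : ∀ i l, F.map i '' F.attractor ≠ E '' (F.map l '' F.attractor) →
      dimH (F.map i '' F.attractor ∩ E '' (F.map l '' F.attractor)) < dimH F.attractor) :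
    F.CommonTilesTile E := by
  classical
  refine ⟨⟨F.map m '' F.attractor, ⟨m, rfl⟩, ⟨_, ⟨n, rfl⟩, hnm.symm⟩⟩, ?_⟩
  set U : Fin N × Fin N → Set (Euc M) := fun p =>
    if F.map p.1 '' F.attractor = E '' (F.map p.2 '' F.attractor) then ∅
    else F.map p.1 '' F.attractor ∩ E '' (F.map p.2 '' F.attractor) with hU
  have hsub : (F.attractor ∩ E '' F.attractor) \ ⋃₀ (F.T₀ ∩ moveTiling E F.T₀) ⊆ ⋃ p, U p := by
    rintro x ⟨⟨hx, hx'⟩, hnot⟩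
    rw [F.attractor_spec.2.2, Set.image_iUnion] at hx'
    rw [F.attractor_spec.2.2] at hx
    obtain ⟨i, hi⟩ := Set.mem_iUnion.1 hx
    obtain ⟨l, hl⟩ := Set.mem_iUnion.1 hx'
    refine Set.mem_iUnion.2 ⟨(i, l), ?_⟩
    have hne : F.map i '' F.attractor ≠ E '' (F.map l '' F.attractor) := fun heq =>
      hnot ⟨_, ⟨⟨i, rfl⟩, ⟨_, ⟨l, rfl⟩, heq.symm⟩⟩, hi⟩
    simp only [hU, if_neg hne]
    exact ⟨hi, hl⟩
  refine (dimH_mono hsub).trans_lt ?_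
  have : Nonempty (Fin N × Fin N) := ⟨(n, m)⟩
  obtain ⟨p, hp⟩ := exists_eq_ciSup_of_finite (f := fun p => dimH (U p))
  rw [dimH_iUnion, ← hp]
  simp only [hU]
  split_ifs with h
  · rw [dimH_empty]
    exact hF.dimH_pos
  · exact hE _ _ h

/-- Recognizability: if a copy `h T₀` of `T₀` of the right size consists of tiles of level `j`, then
local rigidity forces it to be one of the families into which the tiles of level `j + 1` were
divided. -/
theorem IsTIFS.isBlock_of_subset (hF : F.IsTIFS) {𝒯 : Subgroup (Equiv.Perm (Euc M))}
    (hrigid : ∀ E ∈ 𝒯, F.CommonTilesTile E → E = 1) {j : ℕ} {ψ : Stream' (Fin N)}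
    {h : Equiv.Perm (Euc M)} (hh : F.HasScale h (-j))
    (hmem : ∀ g ∈ Subgroup.closure (Set.range F.map), F.HasScale g (-j) → g⁻¹ * h ∈ 𝒯)
    (hsub : ∀ n, h '' (F.map n '' F.attractor) ∈ F.levelTiling j ψ) : F.IsBlock j ψ h := by
  have : Nonempty (Fin N) := ⟨⟨0, by have := F.two_le; omega⟩⟩
  -- a piece with the largest exponent betrays the tile of level `j + 1` it was cut from
  obtain ⟨n, hn⟩ := Finite.exists_max F.a
  obtain ⟨g, m, hg, heq⟩ := hF.exists_isBlock_of_forall_le hh hn (hsub n)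
  have hcomp : ∀ K : Set (Euc M), g '' ((g⁻¹ * h : Equiv.Perm (Euc M)) '' K) = h '' K := by
    intro K
    rw [← Set.image_comp, ← Equiv.Perm.coe_mul, mul_inv_cancel_left]
  have hE : g⁻¹ * h = 1 := by
    refine hrigid _ (hmem g hg.mem_closure hg.hasScale)
      (hF.commonTilesTile (n := n) (m := m) ?_ fun i l hne => ?_)
    · apply g.injective.image_injective
      rw [hcomp, heq]
    · rw [← hg.hasScale.dimH_image, Set.image_inter g.injective, hcomp]
      refine hF.dimH_inter_lt (hg.image_map_mem i) (hsub l) fun h0 => hne ?_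
      apply g.injective.image_injective
      rw [hcomp, h0]
  rwa [← inv_mul_eq_one.1 hE]

theorem IsTIFS.isBlock_of_levelTiling_subset (hF : F.IsTIFS) {𝒯 : Subgroup (Equiv.Perm (Euc M))}
    (h𝒯 : F.generatedIsometries ≤ 𝒯) (hrigid : ∀ E ∈ 𝒯, F.CommonTilesTile E → E = 1) {j : ℕ}
    {θ ψ : Stream' (Fin N)} (hsub : F.levelTiling j θ ⊆ F.levelTiling j ψ)
    {h : Equiv.Perm (Euc M)} (hh : F.IsBlock j θ h) : F.IsBlock j ψ h := by
  refine hF.isBlock_of_subset hrigid hh.hasScale (fun g hg hgs => h𝒯 ⟨?_, ?_⟩)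
    fun n => hsub (hh.image_map_mem n)
  · exact Subgroup.mul_mem _ (Subgroup.inv_mem _ hg) hh.mem_closure
  · refine F.hasScale_zero_iff.1 ?_
    simpa using hgs.inv.mul hh.hasScale

/-- Tilings which agree at level `j` agree at level `j + 1`: the deflation of a tiling is
determined by the tiling. -/
theorem IsTIFS.levelTiling_succ_subset (hF : F.IsTIFS) {𝒯 : Subgroup (Equiv.Perm (Euc M))}
    (h𝒯 : F.generatedIsometries ≤ 𝒯) (hrigid : ∀ E ∈ 𝒯, F.CommonTilesTile E → E = 1) {j : ℕ}
    {θ ψ : Stream' (Fin N)} (heq : F.levelTiling j θ = F.levelTiling j ψ) :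
    F.levelTiling (j + 1) θ ⊆ F.levelTiling (j + 1) ψ := by
  intro t ht
  rcases mem_levelTiling_succ ht with h | ⟨h, hh, rfl⟩
  swap
  · exact (hF.isBlock_of_levelTiling_subset h𝒯 hrigid heq.subset hh).image_mem
  rw [heq] at h
  rcases mem_levelTiling h with h | ⟨g, n, hg, rfl⟩
  · exact h
  -- otherwise both `g(A)` and its proper part `g f_n(A)` would be tiles of level `j + 1` for `θ`
  exfalso
  have hgθ := hF.isBlock_of_levelTiling_subset h𝒯 hrigid heq.symm.subset hg
  have hscale := hg.hasScale.mul (F.hasScale_map n)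
  have himage : g '' (F.map n '' F.attractor) = (g * F.map n) '' F.attractor := by
    rw [Equiv.Perm.coe_mul, Set.image_comp]
  have hne : g '' (F.map n '' F.attractor) ≠ g '' F.attractor := by
    intro h0
    rw [himage] at h0
    have := hF.scale_eq hscale hg.hasScale h0
    have := F.a_pos n
    omega
  have hlt := hF.dimH_inter_lt ht hgθ.image_mem hne
  rw [Set.inter_eq_left.2 (Set.image_mono (F.map_image_attractor_subset n)), himage,
    hscale.dimH_image] at hlt
  exact hlt.false

theorem IsTIFS.levelTiling_eq (hF : F.IsTIFS) {𝒯 : Subgroup (Equiv.Perm (Euc M))}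
    (h𝒯 : F.generatedIsometries ≤ 𝒯) (hrigid : ∀ E ∈ 𝒯, F.CommonTilesTile E → E = 1)
    {θ ψ : Stream' (Fin N)} (heq : F.tiling θ = F.tiling ψ) (j : ℕ) :
    F.levelTiling j θ = F.levelTiling j ψ := by
  induction j with
  | zero => rw [← tiling_eq_levelTiling, ← tiling_eq_levelTiling, heq]
  | succ j ih =>
    exact (hF.levelTiling_succ_subset h𝒯 hrigid ih).antisymm
      (hF.levelTiling_succ_subset h𝒯 hrigid ih.symm)

/-- An infinite word can be recovered from its tiling: `f_{-θ|k}(A)` is a tile of some level of the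
hierarchy, and non-overlap makes its address in `Π(ψ)` unique. -/
theorem IsTIFS.tiling_injective (hF : F.IsTIFS) {𝒯 : Subgroup (Equiv.Perm (Euc M))}
    (h𝒯 : F.generatedIsometries ≤ 𝒯) (hrigid : ∀ E ∈ 𝒯, F.CommonTilesTile E → E = 1) :
    Function.Injective F.tiling := by
  intro θ ψ heq
  refine Stream'.take_theorem θ ψ fun k => ?_
  have hθ : F.IsBlock (F.xi (θ.take k)) θ (F.negWord (θ.take k)) := ⟨k, [], by simp, by simp⟩
  obtain ⟨l, σ, -, he⟩ := hF.isBlock_of_levelTiling_subset h𝒯 hrigid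
    (hF.levelTiling_eq h𝒯 hrigid heq (F.xi (θ.take k))).subset hθ
  have hw : F.word (ψ.take l).reverse = F.word (σ ++ (θ.take k).reverse) := by
    rw [negWord_eq, negWord_eq, inv_eq_iff_eq_inv, mul_inv_rev, inv_inv] at he
    rw [word_append, he, mul_inv_cancel_left]
  have hlist : ψ.take l = θ.take k ++ σ.reverse := by
    rw [← List.reverse_inj, hF.word_injective hw]
    simp
  have hlen : l = k + σ.length := by simpa using congrArg List.length hlist
  have := congrArg (List.take k) hlist
  rw [Stream'.take_take, List.take_left' (by simp), min_eq_right (by omega)] at this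
  exact this.symm

/-! ### Tilings and addresses up to equivalence -/

variable (F)

theorem moveTiling_tiling_subset {θ ψ : Stream' (Fin N)} {p q : ℕ}
    (hxi : F.xi (θ.take p) = F.xi (ψ.take q)) (hdrop : θ.drop p = ψ.drop q) :
    moveTiling (F.negWord (θ.take p) * (F.negWord (ψ.take q))⁻¹) (F.tiling ψ) ⊆ F.tiling θ := by
  rw [tiling_eq_levelTiling, tiling_eq_levelTiling]
  rintro _ ⟨_, ⟨k, σ, h₁, h₂, rfl⟩, rfl⟩
  obtain ⟨σ, h₁, h₂, he⟩ := F.levelTiling_lift h₁ h₂ (Nat.le_add_left k q)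
  have hk : F.xi (θ.take (p + k)) = F.xi (ψ.take (q + k)) := by
    rw [xi_take_add, xi_take_add, hxi, hdrop]
  refine ⟨p + k, σ, by omega, by omega, ?_⟩
  beta_reduce
  rw [← he, ← Set.image_comp, ← Equiv.Perm.coe_mul, Stream'.take_add, Stream'.take_add,
    negWord_append, negWord_append, hdrop]
  congr 2
  group

theorem moveTiling_tiling {θ ψ : Stream' (Fin N)} {p q : ℕ}
    (hxi : F.xi (θ.take p) = F.xi (ψ.take q)) (hdrop : θ.drop p = ψ.drop q) :
    moveTiling (F.negWord (θ.take p) * (F.negWord (ψ.take q))⁻¹) (F.tiling ψ) = F.tiling θ := by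
  refine (F.moveTiling_tiling_subset hxi hdrop).antisymm ?_
  have h := Set.image_mono
    (f := fun t => (F.negWord (θ.take p) * (F.negWord (ψ.take q))⁻¹) '' t)
    (F.moveTiling_tiling_subset hxi.symm hdrop.symm)
  change moveTiling _ (moveTiling _ _) ⊆ moveTiling _ _ at h
  rwa [← moveTiling_mul, show F.negWord (θ.take p) * (F.negWord (ψ.take q))⁻¹ *
    (F.negWord (ψ.take q) * (F.negWord (θ.take p))⁻¹) = 1 by group, moveTiling_one] at h

/-- Equivalent addresses have congruent tilings. -/
theorem tilingClass_eq {𝒯 : Subgroup (Equiv.Perm (Euc M))} (h𝒯 : F.generatedIsometries ≤ 𝒯)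
    {θ ψ : Stream' (Fin N)} (h : F.addressSetoid θ ψ) :
    F.tilingClass 𝒯 θ = F.tilingClass 𝒯 ψ := by
  obtain ⟨p, q, hxi, hdrop⟩ := h
  refine Quotient.sound ⟨1, 𝒯.one_mem, F.negWord (θ.take p) * (F.negWord (ψ.take q))⁻¹,
    h𝒯 ⟨Subgroup.mul_mem _ (F.negWord_mem_closure _)
      (Subgroup.inv_mem _ (F.negWord_mem_closure _)),
      F.hasScale_zero_iff.1 ?_⟩, ?_⟩
  · have := (F.hasScale_negWord (θ.take p)).mul (F.hasScale_negWord (ψ.take q)).inv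
    rwa [hxi, neg_neg, neg_add_cancel] at this
  · rw [moveTiling_one]
    exact (F.moveTiling_tiling hxi hdrop).symm

theorem isBlock_zero_one (θ : Stream' (Fin N)) : F.IsBlock 0 θ 1 :=
  ⟨0, [], by simp, by simp [negWord]⟩

variable {F}

/-- Congruent tilings have equivalent addresses. As `T₀ ⊆ Π(θ)`, an isometry `E` with
`E Π(θ) = Π(ψ)` carries `T₀` into `Π(ψ)`, so it has the form `f_{-ψ|k} f_σ`. Replacing the prefix
`ψ|k` by the reversal of `σ` gives an equivalent address whose tiling is exactly `Π(θ)`. -/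
theorem IsTIFS.addressSetoid_of_moveTiling_eq (hF : F.IsTIFS)
    {𝒯 : Subgroup (Equiv.Perm (Euc M))} (h𝒯 : F.generatedIsometries ≤ 𝒯)
    (h𝒯' : 𝒯 ≤ euclideanIsometries M) (hrigid : ∀ E ∈ 𝒯, F.CommonTilesTile E → E = 1)
    {θ ψ : Stream' (Fin N)} {E : Equiv.Perm (Euc M)} (hE : E ∈ 𝒯)
    (heq : moveTiling E (F.tiling θ) = F.tiling ψ) : F.addressSetoid θ ψ := by
  have hblock : F.IsBlock 0 ψ E := by
    refine hF.isBlock_of_subset hrigid (F.hasScale_zero_iff.2 (h𝒯' hE)) (fun g hg hgs => ?_)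
      fun n => ?_
    · exact mul_mem (inv_mem (h𝒯 ⟨hg, F.hasScale_zero_iff.1 hgs⟩)) hE
    · rw [← tiling_eq_levelTiling, ← heq, tiling_eq_levelTiling]
      have := (F.isBlock_zero_one θ).image_map_mem n
      rw [Equiv.Perm.coe_one, Set.image_id] at this
      exact ⟨_, this, rfl⟩
  obtain ⟨k, σ, hk, rfl⟩ := hblock
  have htake : (σ.reverse ++ₛ ψ.drop k).take σ.length = σ.reverse := by
    rw [← List.length_reverse, take_length_append]
  have hdrop : (σ.reverse ++ₛ ψ.drop k).drop σ.length = ψ.drop k := by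
    rw [← List.length_reverse, Stream'.drop_append_stream]
  have hxi : F.xi (ψ.take k) = F.xi ((σ.reverse ++ₛ ψ.drop k).take σ.length) := by
    rw [htake, xi_reverse]
    omega
  have hmove := F.moveTiling_tiling hxi hdrop.symm
  rw [htake, F.negWord_eq σ.reverse, List.reverse_reverse, inv_inv, ← heq] at hmove
  have htil : F.tiling (σ.reverse ++ₛ ψ.drop k) = F.tiling θ :=
    (Equiv.injective (F.negWord (ψ.take k) * F.word σ)).image_injective.image_injective hmove
  rw [← hF.tiling_injective h𝒯 hrigid htil]
  exact ⟨σ.length, k, hxi.symm, hdrop⟩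

/-- The map `Π̃`. -/
noncomputable def tilingEquiv (hF : F.IsTIFS)
    {𝒯 : Subgroup (Equiv.Perm (Euc M))} (h𝒯 : F.generatedIsometries ≤ 𝒯)
    (h𝒯' : 𝒯 ≤ euclideanIsometries M) (hrigid : ∀ E ∈ 𝒯, F.CommonTilesTile E → E = 1) :
    F.AddressSpace ≃ F.TilingSpace 𝒯 :=
  Equiv.ofBijective (Quotient.lift (F.tilingClass 𝒯) fun _ _ => F.tilingClass_eq h𝒯) <| by
    constructor
    · rintro ⟨θ⟩ ⟨ψ⟩ h
      obtain ⟨E₁, h₁, E₂, h₂, h⟩ := Quotient.exact h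
      refine Quotient.sound (hF.addressSetoid_of_moveTiling_eq h𝒯 h𝒯' hrigid
        (mul_mem (inv_mem h₂) h₁) ?_)
      rw [moveTiling_mul, h, ← moveTiling_mul, inv_mul_cancel, moveTiling_one]
    · rintro ⟨_, θ, rfl⟩
      exact ⟨F.addressClass θ, rfl⟩

/-- The homeomorphism `Π̃` of the discrete spaces of addresses and tilings. -/
noncomputable def tilingHomeomorph (hF : F.IsTIFS)
    {𝒯 : Subgroup (Equiv.Perm (Euc M))} (h𝒯 : F.generatedIsometries ≤ 𝒯)
    (h𝒯' : 𝒯 ≤ euclideanIsometries M) (hrigid : ∀ E ∈ 𝒯, F.CommonTilesTile E → E = 1) :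
    F.AddressSpace ≃ₜ F.TilingSpace 𝒯 where
  toEquiv := tilingEquiv hF h𝒯 h𝒯' hrigid
  continuous_toFun := continuous_of_discreteTopology
  continuous_invFun := continuous_of_discreteTopology

end SimilitudeIFS

theorem mainTheorem4 {M N : ℕ} (F : SimilitudeIFS M N) (hF : F.IsTIFS)
    (𝒯 : Subgroup (Equiv.Perm (Euc M)))
    (h𝒯 : F.generatedIsometries ≤ 𝒯) (h𝒯' : 𝒯 ≤ euclideanIsometries M)
    (hrigid : F.IsLocallyRigid 𝒯) :
    -- the words needed to define the modified shift and its inverse exist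
    (∀ θ : Stream' (Fin N), ∀ᶠ j in Filter.atTop,
      (∃ w : List (Fin N), F.xi w + 1 = F.xi (θ.take j)) ∧
      (∃ w' : List (Fin N), F.xi w' = F.xi (θ.take j) + 1)) ∧
    ∃ (Stilde : F.AddressSpace ≃ₜ F.AddressSpace)
      (αtilde : F.TilingSpace 𝒯 ≃ₜ F.TilingSpace 𝒯)
      (Pitilde : F.AddressSpace ≃ₜ F.TilingSpace 𝒯),
      -- the modified shift and its inverse, for all choices of `j` and of the words
      (∀ (θ : Stream' (Fin N)) (j : ℕ) (w : List (Fin N)), F.xi w + 1 = F.xi (θ.take j) →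
        Stilde (F.addressClass θ) = F.addressClass (w ++ₛ θ.drop j)) ∧
      (∀ (θ : Stream' (Fin N)) (j : ℕ) (w' : List (Fin N)), F.xi w' = F.xi (θ.take j) + 1 →
        Stilde.symm (F.addressClass θ) = F.addressClass (w' ++ₛ θ.drop j)) ∧
      -- `Π̃[θ] = [Π(θ)]`
      (∀ θ : Stream' (Fin N), Pitilde (F.addressClass θ) = F.tilingClass 𝒯 θ) ∧
      -- `α̃[Π(θ)] = [Π(S̃[θ])]` and the same for the inverses, for all representatives
      (∀ θ ψ : Stream' (Fin N), Stilde (F.addressClass θ) = F.addressClass ψ →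
        αtilde (F.tilingClass 𝒯 θ) = F.tilingClass 𝒯 ψ) ∧
      (∀ θ ψ : Stream' (Fin N), Stilde.symm (F.addressClass θ) = F.addressClass ψ →
        αtilde.symm (F.tilingClass 𝒯 θ) = F.tilingClass 𝒯 ψ) ∧
      -- the two diagrams commute
      Pitilde ∘ Stilde = αtilde ∘ Pitilde ∧
      Pitilde.symm ∘ αtilde.symm = Stilde.symm ∘ Pitilde.symm := by
  constructor
  · intro θ
    obtain ⟨n, hn⟩ := F.exists_forall_ge_exists_xi_eq hF.1
    filter_upwards [Filter.eventually_ge_atTop (n + 1)] with j hj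
    have hle := F.le_xi_take θ j
    obtain ⟨w, hw⟩ := hn (F.xi (θ.take j) - 1) (by omega)
    exact ⟨⟨w, by omega⟩, hn _ (by omega)⟩
  let S := F.modifiedShift hF.1
  let P := SimilitudeIFS.tilingHomeomorph hF h𝒯 h𝒯' hrigid.1
  have hP : ∀ θ, P.symm (F.tilingClass 𝒯 θ) = F.addressClass θ := fun θ =>
    P.symm_apply_eq.2 rfl
  -- `α̃` is the conjugate of `S̃` by `Π̃`
  refine ⟨S, (P.symm.trans S).trans P, P, ?_, ?_, fun _ => rfl, ?_, ?_, ?_, ?_⟩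
  · intro θ j w hw
    exact F.shiftBy_addressClass hF.1 (F.tailRel_append θ j w (by omega))
  · intro θ j w hw
    exact F.shiftBy_addressClass hF.1 (F.tailRel_append θ j w (by omega))
  · intro θ ψ h
    change P (S (P.symm _)) = _
    rw [hP, h]
    rfl
  · intro θ ψ h
    change P (S.symm (P.symm _)) = _
    rw [hP, h]
    rfl
  · funext c
    simp
  · funext c
    simp
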